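/- Let $A\in\mathbb C^{n\times n}$, $B\in\mathbb C^{n\times m}$, let $R\in\mathbb C^{m\times m}$ be Hermitian and nonsingular and $H\in\mathbb C^{n\times n}$ Hermitian. Write $\overline M$ for the entrywise conjugate, $M^H$ for the conjugate transpose, $\rho$ for the spectral radius, $\|\cdot\|$ for the spectral norm, and $M\ge N$ if $M-N$ is Hermitian positive semidefinite. For Hermitian $X\in\mathbb C^{n\times n}$ put $R_X=R+B^H\overline XB$, and let $\mathrm{dom}(\mathcal R)$ be the set of Hermitian $X$ with $\det R_X\neq0$. For $X\in\mathrm{dom}(\mathcal R)$ put $$\mathcal R(X)=A^H\overline XA-A^H\overline XB\,R_X^{-1}B^H\overline XA+H,\quad F_X=R_X^{-1}B^H\overline XA,\quad T_X=A-BF_X,\quad \widehat T_X=\overline{T_X}\,T_X .$$ A solution of the CDARE is an $X\in\mathrm{dom}(\mathcal R)$ with $X=\mathcal R(X)$; a solution $X_M$ is maximal if $X_M\ge X$ for every solution $X$. Let $\mathbb T=\{X\in\mathrm{dom}(\mathcal R):\rho(\widehat T_X)<1\}$, $\mathbb P=\{X\in\mathrm{dom}(\mathcal R):R_X>0\}$,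 $\mathcal R_\le=\{X\in\mathrm{dom}(\mathcal R):X\le\mathcal R(X)\}$, and let $\mathcal S_\ge$ be the set of Hermitian $X$ such that $X-T_W^H\overline XT_W\ge H+F_W^HRF_W$ for some $W\in\mathbb T$. Assume $\mathbb T\ne\emptyset$, $\mathcal R_\le\cap\mathbb P\neq\emptyset$ and $\det R_H\ne0$, where $R_H=R+B^H\overline HB$. Put $G=BR^{-1}B^H$, $\widehat A=\overline AA-\overline AB R_H^{-1}B^H\overline HA$, $\widehat B=[\,\overline B\ \ \overline AB\,]$, $\widehat R=\overline R\oplus R_H$, $\widehat G=\widehat B\widehat R^{-1}\widehat B^H$ and $\widehat H=H+A^H\overline H(I+G\overline H)^{-1}A$. For an integer $r>1$, AFPI($r$) is the following iteration. Let $(\mathbf A_0,\mathbf G_0,\mathbf H_0)=(\widehat A,\widehat G,\widehat H)$. Given $(\mathbf A_k,\mathbf G_k,\mathbf H_k)$, put $(A_k^{(1)},G_k^{(1)},H_k^{(1)})=(\mathbf A_k,\mathbf G_k,\mathbf H_k)$ and, for $l=1,\dots,r-1$, with $\Delta=(I+\mathbf G_kH_k^{(l)})^{-1}$, $$A_k^{(l+1)}=A_k^{(l)}\Delta\mathbf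 A_k,\quad G_k^{(l+1)}=G_k^{(l)}+A_k^{(l)}\Delta\mathbf G_k(A_k^{(l)})^H,\quad H_k^{(l+1)}=\mathbf H_k+\mathbf A_k^HH_k^{(l)}\Delta\mathbf A_k ;$$ then $(\mathbf A_{k+1},\mathbf G_{k+1},\mathbf H_{k+1})=(A_k^{(r)},G_k^{(r)},H_k^{(r)})$ and $$\widehat Y_{k+1}=\mathbf A_{k+1}^H\widehat Y_0(I+\mathbf G_{k+1}\widehat Y_0)^{-1}\mathbf A_{k+1}+\mathbf H_{k+1}.$$ Assume that the recursion for the triples does not break down, i.e. all $I+\mathbf G_kH_k^{(l)}$ with $k\ge0$, $1\le l\le r-1$ are nonsingular, and let $\widehat Y_0=X_0\in\mathcal S_\ge$. Then the CDARE has a maximal solution $X_M$, and $R_{X_M}>0$; all matrices $I+\mathbf G_{k+1}\widehat Y_0$, $k\ge0$, are nonsingular; and $(\widehat Y_k)_{k\ge0}$ is nonincreasing and converges to $X_M$. If moreover $\rho(\widehat T_{X_M})<1$, then the convergence is superlinear, in the sense that $\lim_{k\to\infty}\|\widehat Y_k-X_M\|^{1/k}=0$, and $$\limsup_{k\to\infty}\|\widehat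 Y_k-X_M\|^{1/r^k}\le\rho(\widehat T_{X_M})^2 .$$ -/

import Mathlib

open Matrix Filter Topology
open scoped ComplexOrder MatrixOrder Matrix.Norms.L2Operator

noncomputable section

/-- Entrywise complex conjugate of a matrix. -/
def cconj {p q : Type*} (M : Matrix p q ℂ) : Matrix p q ℂ := M.map star

/-- Coefficient matrices of the conjugate discrete-time algebraic Riccati equation
`X = Aᴴ X̄ A - Aᴴ X̄ B (R + Bᴴ X̄ B)⁻¹ Bᴴ X̄ A + H`. -/
structure CDARE (n m : ℕ) where
  A : Matrix (Fin n) (Fin n) ℂ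
  B : Matrix (Fin n) (Fin m) ℂ
  R : Matrix (Fin m) (Fin m) ℂ
  H : Matrix (Fin n) (Fin n) ℂ

namespace CDARE

variable {n m : ℕ} (E : CDARE n m)

/-- `R_X = R + Bᴴ X̄ B`. -/
def RX (X : Matrix (Fin n) (Fin n) ℂ) : Matrix (Fin m) (Fin m) ℂ :=
  E.R + E.Bᴴ * cconj X * E.B

/-- The domain of the Riccati operator: Hermitian `X` with `R_X` nonsingular. -/
def dom : Set (Matrix (Fin n) (Fin n) ℂ) :=
  {X | X.IsHermitian ∧ (E.RX X).det ≠ 0}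

/-- The conjugate Riccati operator (meaningful on `E.dom`). -/
def ric (X : Matrix (Fin n) (Fin n) ℂ) : Matrix (Fin n) (Fin n) ℂ :=
  E.Aᴴ * cconj X * E.A
    - E.Aᴴ * cconj X * E.B * (E.RX X)⁻¹ * E.Bᴴ * cconj X * E.A + E.H

/-- The set of (Hermitian) solutions of the CDARE. -/
def solutions : Set (Matrix (Fin n) (Fin n) ℂ) := {X | X ∈ E.dom ∧ X = E.ric X}

/-- The set of `X` in the domain with `X ≤ ric X`. -/
def ricLE : Set (Matrix (Fin n) (Fin n) ℂ) := {X | X ∈ E.dom ∧ X ≤ E.ric X}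

/-- The set of `X` in the domain with `R_X` positive definite. -/
def posSet : Set (Matrix (Fin n) (Fin n) ℂ) := {X | X ∈ E.dom ∧ (E.RX X).PosDef}

/-- Feedback matrix `F_X = R_X⁻¹ Bᴴ X̄ A`. -/
def feedback (X : Matrix (Fin n) (Fin n) ℂ) : Matrix (Fin m) (Fin n) ℂ :=
  (E.RX X)⁻¹ * E.Bᴴ * cconj X * E.A

/-- `T_X = A - B F_X`. -/
def closedLoop (X : Matrix (Fin n) (Fin n) ℂ) : Matrix (Fin n) (Fin n) ℂ :=
  E.A - E.B * E.feedback X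

/-- The closed-loop matrix `conj(T_X) T_X`. -/
def closedLoopHat (X : Matrix (Fin n) (Fin n) ℂ) : Matrix (Fin n) (Fin n) ℂ :=
  cconj (E.closedLoop X) * E.closedLoop X

/-- The set of stabilizing `X`: `ρ(conj(T_X) T_X) < 1`. -/
def stabSet : Set (Matrix (Fin n) (Fin n) ℂ) :=
  {X | X ∈ E.dom ∧ spectralRadius ℂ (E.closedLoopHat X) < 1}

/-- The set of admissible initial matrices: Hermitian `X` such that, for some stabilizing `W`,
`X - T_Wᴴ X̄ T_W ≥ H + F_Wᴴ R F_W`. -/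
def startSet : Set (Matrix (Fin n) (Fin n) ℂ) :=
  {X | X.IsHermitian ∧ ∃ W ∈ E.stabSet,
    E.H + (E.feedback W)ᴴ * E.R * E.feedback W
      ≤ X - (E.closedLoop W)ᴴ * cconj X * E.closedLoop W}

/-! Coefficients of the transformed DARE `X = Âᴴ X (I + Ĝ X)⁻¹ Â + Ĥ`. -/

/-- `G = B R⁻¹ Bᴴ`. -/
def G : Matrix (Fin n) (Fin n) ℂ := E.B * E.R⁻¹ * E.Bᴴ

/-- `Â = Ā A - Ā B (R + Bᴴ H̄ B)⁻¹ Bᴴ H̄ A`. -/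
def hatA : Matrix (Fin n) (Fin n) ℂ :=
  cconj E.A * E.A - cconj E.A * E.B * (E.RX E.H)⁻¹ * E.Bᴴ * cconj E.H * E.A

/-- `B̂ = [B̄, Ā B]`. -/
def hatB : Matrix (Fin n) (Fin m ⊕ Fin m) ℂ :=
  Matrix.fromCols (cconj E.B) (cconj E.A * E.B)

/-- `R̂ = R̄ ⊕ R_H`. -/
def hatR : Matrix (Fin m ⊕ Fin m) (Fin m ⊕ Fin m) ℂ :=
  Matrix.fromBlocks (cconj E.R) 0 0 (E.RX E.H)

/-- `Ĝ = B̂ R̂⁻¹ B̂ᴴ`. -/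
def hatG : Matrix (Fin n) (Fin n) ℂ := E.hatB * E.hatR⁻¹ * E.hatBᴴ

/-- `Ĥ = H + Aᴴ H̄ (I + G H̄)⁻¹ A`. -/
def hatH : Matrix (Fin n) (Fin n) ℂ :=
  E.H + E.Aᴴ * cconj E.H * (1 + E.G * cconj E.H)⁻¹ * E.A

end CDARE

/-! The accelerated fixed-point iteration AFPI(r). -/

/-- A triple `(A, G, H)` of square matrices. -/
structure AGH (n : ℕ) where
  A : Matrix (Fin n) (Fin n) ℂ
  G : Matrix (Fin n) (Fin n) ℂ
  H : Matrix (Fin n) (Fin n) ℂ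

namespace AGH

variable {n : ℕ}

/-- One pass of the inner loop: from the outer triple `S` and the current inner triple `L` to the
next inner triple. It inverts the matrix `I + S.G * L.H`. -/
def step (S L : AGH n) : AGH n where
  A := L.A * (1 + S.G * L.H)⁻¹ * S.A
  G := L.G + L.A * (1 + S.G * L.H)⁻¹ * S.G * L.Aᴴ
  H := S.H + S.Aᴴ * L.H * (1 + S.G * L.H)⁻¹ * S.A

/-- Inner iterates; `inner S l` is the triple with superscript `l + 1`, so `inner S 0 = S`. -/
def inner (S : AGH n) : ℕ → AGH n
  | 0 => S
  | l + 1 => step S (inner S l)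

/-- Outer iterates: `outer S₀ r (k+1)` is the inner triple with superscript `r` started at
`outer S₀ r k`. -/
def outer (S₀ : AGH n) (r : ℕ) : ℕ → AGH n
  | 0 => S₀
  | k + 1 => inner (outer S₀ r k) (r - 1)

/-- The iterates `Ŷ_k` of AFPI(r) with initial matrix `Y₀`. -/
def afpi (S₀ : AGH n) (r : ℕ) (Y₀ : Matrix (Fin n) (Fin n) ℂ) : ℕ → Matrix (Fin n) (Fin n) ℂ
  | 0 => Y₀
  | k + 1 =>
    (outer S₀ r (k + 1)).Aᴴ * Y₀ * (1 + (outer S₀ r (k + 1)).G * Y₀)⁻¹ * (outer S₀ r (k + 1)).A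
      + (outer S₀ r (k + 1)).H

/-- The recursion for the triples does not break down: all matrices `I + 𝐆_k H_k^{(l)}`,
`k ≥ 0`, `1 ≤ l ≤ r - 1`, that it inverts are nonsingular. -/
def NoBreakdown (S₀ : AGH n) (r : ℕ) : Prop :=
  ∀ k l : ℕ, l + 1 < r →
    (1 + (outer S₀ r k).G * (inner (outer S₀ r k) l).H).det ≠ 0

end AGH

/-- The initial triple `(Â, Ĝ, Ĥ)` for the transformed DARE. -/
def CDARE.hatAGH {n m : ℕ} (E : CDARE n m) : AGH n := ⟨E.hatA, E.hatG, E.hatH⟩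

end

/-! For k ≥ 1, the k-th AFPI(r) iterate is the (2·r^k)-th iterate of the plain fixed-point map `ric`
at X₀. Each triple encodes a fractional linear map, `AGH.step` composes two of them
(`AGH.Maps.step`), and the hatted triple encodes `ric` applied twice (`hatAGH_eq_step`,
`hatAGH_maps`). So r-fold composition at each outer step leaves only plain iteration to study.

Completing the square (`cost_eq`) shows that, where R_X > 0, `ric X` is the least one-step cost over
all feedbacks. Hence `ric` is monotone there (`ric_mono`). Stein inequalities place X₀ above every Z
with Z ≤ `ric Z` and R_Z > 0, and give `ric X₀ ≤ X₀`. The orbit therefore decreases, stays above Z,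
where R > 0 keeps everything defined, and converges to a solution. It is maximal because every
solution Y has R_Y > 0 (`mem_posSet_of_mem_solutions`) and so bounds the orbit from below.

For the rate, using the feedback of X_M at X bounds `ric X - X_M` by a congruence of the conjugated
error with T. Two steps give a congruence with T̂, and Gelfand's formula along the powers r^k
finishes the proof. -/

/-! ### Entrywise conjugation -/

section cconj

variable {p q s : Type*}

theorem cconj_add (M N : Matrix p q ℂ) : cconj (M + N) = cconj M + cconj N := by
  ext; simp [cconj]

theorem cconj_sub (M N : Matrix p q ℂ) : cconj (M - N) = cconj M - cconj N := by
  ext; simp [cconj]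

theorem cconj_mul [Fintype q] (M : Matrix p q ℂ) (N : Matrix q s ℂ) :
    cconj (M * N) = cconj M * cconj N := by
  ext; simp [cconj, Matrix.mul_apply]

theorem cconj_one [DecidableEq p] : cconj (1 : Matrix p p ℂ) = 1 := by
  ext i j; by_cases h : i = j <;> simp [cconj, Matrix.one_apply, h]

theorem cconj_cconj (M : Matrix p q ℂ) : cconj (cconj M) = M := by
  ext; simp [cconj]

theorem cconj_conjTranspose (M : Matrix p q ℂ) : cconj Mᴴ = (cconj M)ᴴ := by
  ext; simp [cconj]

theorem cconj_eq_transpose {M : Matrix p p ℂ} (hM : M.IsHermitian) : cconj M = Mᵀ := by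
  ext i j
  simpa [cconj] using congrFun (congrFun hM.eq j) i

theorem IsHermitian.cconj {M : Matrix p p ℂ} (hM : M.IsHermitian) : (cconj M).IsHermitian := by
  rw [cconj_eq_transpose hM]; exact hM.transpose

theorem PosSemidef.cconj {M : Matrix p p ℂ} (hM : M.PosSemidef) : (cconj M).PosSemidef := by
  rw [cconj_eq_transpose hM.1]; exact hM.transpose

theorem cconj_mono {M N : Matrix p p ℂ} (h : M ≤ N) : cconj M ≤ cconj N := by
  rw [Matrix.le_iff] at h ⊢
  rw [← cconj_sub]; exact PosSemidef.cconj h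

theorem continuous_cconj : Continuous (cconj : Matrix p q ℂ → Matrix p q ℂ) :=
  continuous_id.matrix_map continuous_star

theorem det_cconj [Fintype p] [DecidableEq p] (M : Matrix p p ℂ) :
    (cconj M).det = star M.det := by
  rw [← Matrix.det_conjTranspose, ← Matrix.det_transpose]; rfl

theorem cconj_inv [Fintype p] [DecidableEq p] (M : Matrix p p ℂ) :
    cconj M⁻¹ = (cconj M)⁻¹ := by
  have h : ∀ N : Matrix p p ℂ, cconj N = (Nᴴ)ᵀ := fun N => rfl
  rw [h, h, Matrix.conjTranspose_nonsing_inv, Matrix.transpose_nonsing_inv]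

/-- Congruence by a rectangular matrix preserves the Loewner order. -/
theorem conjTranspose_mul_mul_mono [Fintype p] [Finite q] {M N : Matrix p p ℂ} (h : M ≤ N)
    (C : Matrix p q ℂ) : Cᴴ * M * C ≤ Cᴴ * N * C := by
  rw [Matrix.le_iff] at h ⊢
  have := h.conjTranspose_mul_mul_same C
  rwa [Matrix.mul_sub, Matrix.sub_mul] at this

end cconj

/-! ### One-step costs, monotonicity of `ric`, and positivity of R_X at solutions. -/

namespace CDARE

variable {n m : ℕ} (E : CDARE n m)

theorem isHermitian_RX (hR : E.R.IsHermitian) {X : Matrix (Fin n) (Fin n) ℂ}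
    (hX : X.IsHermitian) : (E.RX X).IsHermitian :=
  hR.add (isHermitian_conjTranspose_mul_mul _ (IsHermitian.cconj hX))

theorem RX_mono {X Y : Matrix (Fin n) (Fin n) ℂ} (h : X ≤ Y) : E.RX X ≤ E.RX Y :=
  add_le_add_right (conjTranspose_mul_mul_mono (cconj_mono h) E.B) E.R

/-- If `R_Y` is positive definite and `Y ≤ X` then `X` is in the domain and `R_X` is positive
definite. -/
theorem mem_posSet_of_le {X Y : Matrix (Fin n) (Fin n) ℂ} (hY : Y ∈ E.posSet) (h : Y ≤ X) :
    X ∈ E.posSet := by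
  have hp : (E.RX X).PosDef := by
    have h1 := hY.2.add_posSemidef (Matrix.le_iff.1 (E.RX_mono h))
    rwa [add_sub_cancel] at h1
  have hX : X.IsHermitian := by
    have h1 := hY.1.1.add (Matrix.le_iff.1 h).1
    rwa [add_sub_cancel] at h1
  exact ⟨⟨hX, hp.det_pos.ne'⟩, hp⟩

theorem RX_mul_feedback {X : Matrix (Fin n) (Fin n) ℂ} (hX : X ∈ E.dom) :
    E.RX X * E.feedback X = E.Bᴴ * cconj X * E.A := by
  simp only [feedback, ← Matrix.mul_assoc, Matrix.mul_nonsing_inv _ (Ne.isUnit hX.2),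
    Matrix.one_mul]

theorem ric_eq (X : Matrix (Fin n) (Fin n) ℂ) :
    E.ric X = E.Aᴴ * cconj X * E.A - E.Aᴴ * cconj X * E.B * E.feedback X + E.H := by
  simp only [ric, feedback, Matrix.mul_assoc]

/-- Completing the square: the one-step cost of the dynamics `x ↦ A x + B u`. -/
theorem cost_eq (hR : E.R.IsHermitian) {X : Matrix (Fin n) (Fin n) ℂ} (hX : X ∈ E.dom)
    {q : Type*} (M : Matrix (Fin n) q ℂ) (U : Matrix (Fin m) q ℂ) :
    (E.A * M + E.B * U)ᴴ * cconj X * (E.A * M + E.B * U) + Uᴴ * E.R * U + Mᴴ * E.H * M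
      = Mᴴ * E.ric X * M
        + (U + E.feedback X * M)ᴴ * E.RX X * (U + E.feedback X * M) := by
  have h1 := E.RX_mul_feedback hX
  have h2 : (E.feedback X)ᴴ * E.RX X = E.Aᴴ * cconj X * E.B := by
    have := congrArg conjTranspose h1
    simpa only [conjTranspose_mul, conjTranspose_conjTranspose, (E.isHermitian_RX hR hX.1).eq,
      (IsHermitian.cconj hX.1).eq, Matrix.mul_assoc] using this
  have h3 : (U + E.feedback X * M)ᴴ * E.RX X * (U + E.feedback X * M)
      = Uᴴ * E.RX X * U + Uᴴ * (E.RX X * E.feedback X) * M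
        + Mᴴ * ((E.feedback X)ᴴ * E.RX X) * U
        + Mᴴ * ((E.feedback X)ᴴ * E.RX X) * E.feedback X * M := by
    simp only [conjTranspose_add, conjTranspose_mul, Matrix.add_mul, Matrix.mul_add,
      Matrix.mul_assoc]
    abel
  rw [h3, h1, h2, E.ric_eq, RX]
  simp only [conjTranspose_add, conjTranspose_mul, Matrix.add_mul, Matrix.mul_add,
    Matrix.sub_mul, Matrix.mul_sub, Matrix.mul_assoc]
  abel

theorem ric_add_feedback_sub (hR : E.R.IsHermitian) {X : Matrix (Fin n) (Fin n) ℂ}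
    (hX : X ∈ E.dom) (F : Matrix (Fin m) (Fin n) ℂ) :
    (E.A - E.B * F)ᴴ * cconj X * (E.A - E.B * F) + Fᴴ * E.R * F + E.H
      = E.ric X + (E.feedback X - F)ᴴ * E.RX X * (E.feedback X - F) := by
  have := E.cost_eq hR hX 1 (-F)
  simpa [sub_eq_add_neg, add_comm (-F)] using this

/-- `feedback X` minimises the one-step cost: the excess of any other `F` is a congruence of R_X >
0. -/
theorem ric_le (hR : E.R.IsHermitian) {X : Matrix (Fin n) (Fin n) ℂ} (hX : X ∈ E.posSet)
    (F : Matrix (Fin m) (Fin n) ℂ) :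
    E.ric X ≤ (E.A - E.B * F)ᴴ * cconj X * (E.A - E.B * F) + Fᴴ * E.R * F + E.H := by
  rw [E.ric_add_feedback_sub hR hX.1, Matrix.le_iff, add_sub_cancel_left]
  exact hX.2.posSemidef.conjTranspose_mul_mul_same _

theorem ric_eq_closedLoop (hR : E.R.IsHermitian) {X : Matrix (Fin n) (Fin n) ℂ}
    (hX : X ∈ E.dom) :
    E.ric X = (E.closedLoop X)ᴴ * cconj X * E.closedLoop X
      + (E.feedback X)ᴴ * E.R * E.feedback X + E.H := by
  simpa [closedLoop] using (E.ric_add_feedback_sub hR hX (E.feedback X)).symm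

/-- The optimal feedback for `X` is merely admissible for `Y`, and for a fixed feedback the cost is
monotone in the matrix. -/
theorem ric_mono (hR : E.R.IsHermitian) {X Y : Matrix (Fin n) (Fin n) ℂ} (hY : Y ∈ E.posSet)
    (h : Y ≤ X) : E.ric Y ≤ E.ric X := by
  rw [E.ric_eq_closedLoop hR (E.mem_posSet_of_le hY h).1]
  refine (E.ric_le hR hY (E.feedback X)).trans ?_
  gcongr
  exact conjTranspose_mul_mul_mono (cconj_mono h) _

/-- Comparison of a step of the fixed-point iteration with a solution. -/
theorem ric_sub_le (hR : E.R.IsHermitian) {X Y : Matrix (Fin n) (Fin n) ℂ} (hX : X ∈ E.posSet)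
    (hY : Y ∈ E.solutions) :
    E.ric X - Y ≤ (E.closedLoop Y)ᴴ * cconj (X - Y) * E.closedLoop Y := by
  have h1 := E.ric_le hR hX (E.feedback Y)
  have h2 := hY.2.trans (E.ric_eq_closedLoop hR hY.1)
  calc E.ric X - Y ≤ _ - Y := sub_le_sub_right h1 Y
    _ = (E.closedLoop Y)ᴴ * cconj X * E.closedLoop Y
        + (E.feedback Y)ᴴ * E.R * E.feedback Y + E.H
        - ((E.closedLoop Y)ᴴ * cconj Y * E.closedLoop Y
        + (E.feedback Y)ᴴ * E.R * E.feedback Y + E.H) := by rw [← h2]; rfl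
    _ = _ := by rw [cconj_sub, Matrix.mul_sub, Matrix.sub_mul]; abel

/-- A two-step cycle `M → y → λ M` with `|λ| = 1`: the total cost does not depend on `X`. -/
theorem cycle_cost_eq (hR : E.R.IsHermitian) {X : Matrix (Fin n) (Fin n) ℂ} (hX : X ∈ E.dom)
    {q : Type*} {M y : Matrix (Fin n) q ℂ} {U V : Matrix (Fin m) q ℂ} {c : ℂ}
    (hc : star c * c = 1) (hy : cconj y = E.A * M + E.B * U)
    (hM : cconj (c • M) = E.A * y + E.B * V) :
    Uᴴ * E.R * U + Mᴴ * E.H * M + cconj (Vᴴ * E.R * V + yᴴ * E.H * y)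
      = Mᴴ * (E.ric X - X) * M + cconj (yᴴ * (E.ric X - X) * y)
        + (U + E.feedback X * M)ᴴ * E.RX X * (U + E.feedback X * M)
        + cconj ((V + E.feedback X * y)ᴴ * E.RX X * (V + E.feedback X * y)) := by
  have h1 := E.cost_eq hR hX M U
  have h2 := congrArg cconj (E.cost_eq hR hX y V)
  rw [← hy] at h1
  rw [← hM] at h2
  -- A unimodular `c` leaves the quadratic form unchanged, so the terminal cost of the cycle cancels
  -- its initial one.
  have h3 : cconj ((cconj (c • M))ᴴ * cconj X * cconj (c • M)) = Mᴴ * X * M := by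
    rw [← cconj_conjTranspose, ← cconj_mul, ← cconj_mul, cconj_cconj, conjTranspose_smul,
      Matrix.smul_mul, Matrix.smul_mul, Matrix.mul_smul, smul_smul, hc, one_smul]
  have h4 : (cconj y)ᴴ * cconj X * cconj y = cconj (yᴴ * X * y) := by
    rw [← cconj_conjTranspose, ← cconj_mul, ← cconj_mul]
  simp only [cconj_add, h3] at h2
  rw [h4] at h1
  simp only [Matrix.mul_sub, Matrix.sub_mul, cconj_sub, cconj_add]
  have h5 := congrArg₂ (· - ·) (congrArg₂ (· + ·) h1 h2)
    (Eq.refl (cconj (yᴴ * X * y) + Mᴴ * X * M))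
  convert h5 using 1 <;> abel

theorem exists_unit_circle_notMem_spectrum (T : Matrix (Fin n) (Fin n) ℂ) :
    ∃ c : ℂ, star c * c = 1 ∧ c ∉ spectrum ℂ T := by
  have hinf : (Metric.sphere (0 : ℂ) 1).Infinite := by
    refine IsPreconnected.infinite_of_nontrivial ?_ ⟨1, by simp, -1, by simp, by norm_num⟩
    exact (isPreconnected_sphere (by simp) 0 1)
  obtain ⟨c, hc, hcT⟩ := (hinf.sdiff (Matrix.finite_spectrum T)).nonempty
  refine ⟨c, ?_, hcT⟩
  have : ‖c‖ = 1 := by simpa using hc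
  rw [Complex.star_def, Complex.conj_mul', this]; simp

/-- If some `Z` satisfies `Z ≤ ric Z` and `R_Z > 0`, every solution `X` has `R_X > 0`. -/
theorem mem_posSet_of_mem_solutions (hR : E.R.IsHermitian) {X Z : Matrix (Fin n) (Fin n) ℂ}
    (hZ : Z ∈ E.ricLE) (hZp : Z ∈ E.posSet) (hX : X ∈ E.solutions) : X ∈ E.posSet := by
  obtain ⟨c, hc, hcT⟩ := exists_unit_circle_notMem_spectrum (E.closedLoopHat X)
  rw [spectrum.notMem_iff, Matrix.isUnit_iff_isUnit_det, Algebra.algebraMap_eq_smul_one] at hcT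
  set T := E.closedLoop X with hT
  -- Periodic orbit, up to the factor `c`, of the closed loop of `X` driven by a unit input in the
  -- first of its two steps; it exists because `c` is not an eigenvalue of T̂_X.
  obtain ⟨M, hM⟩ : ∃ M : Matrix (Fin n) (Fin m) ℂ, c • M = cconj T * (T * M + E.B) := by
    refine ⟨(c • (1 : Matrix (Fin n) (Fin n) ℂ) - E.closedLoopHat X)⁻¹ * (cconj T * E.B), ?_⟩
    have h := Matrix.mul_nonsing_inv_cancel_left _ (cconj T * E.B) hcT
    rw [Matrix.sub_mul, Matrix.smul_mul, Matrix.one_mul, sub_eq_iff_eq_add] at h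
    rw [h]
    simp only [closedLoopHat, ← hT, Matrix.mul_add, Matrix.mul_assoc, add_comm]
  have hy : cconj (cconj (T * M + E.B)) = E.A * M + E.B * (1 - E.feedback X * M) := by
    rw [cconj_cconj, hT, closedLoop, Matrix.sub_mul, Matrix.mul_sub, Matrix.mul_one,
      Matrix.mul_assoc]
    abel
  have hM' : cconj (c • M) = E.A * cconj (T * M + E.B)
      + E.B * (-(E.feedback X * cconj (T * M + E.B))) := by
    rw [hM, cconj_mul, cconj_cconj, Matrix.mul_neg, ← Matrix.mul_assoc E.B, ← sub_eq_add_neg,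
      ← Matrix.sub_mul]
    rfl
  have hXeq := E.cycle_cost_eq hR hX.1 hc hy hM'
  -- The cost of this cycle is evaluated twice. Through `X` only R_X survives, since `ric X = X` and
  -- the input deviations from feedback are 1 and 0; through `Z` every term is positive
  -- semidefinite.
  rw [E.cycle_cost_eq hR hZ.1 hc hy hM', ← hX.2] at hXeq
  replace hXeq := hXeq.trans (c := E.RX X) (by
    have h0 : cconj (0 : Matrix (Fin m) (Fin m) ℂ) = 0 := by ext; simp [cconj]
    simp [h0])
  have hZd := Matrix.le_iff.1 hZ.2
  have hpsd : (E.RX X).PosSemidef := by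
    rw [← hXeq]
    exact (((hZd.conjTranspose_mul_mul_same _).add
      (PosSemidef.cconj (hZd.conjTranspose_mul_mul_same _))).add
      (hZp.2.posSemidef.conjTranspose_mul_mul_same _)).add
      (PosSemidef.cconj (hZp.2.posSemidef.conjTranspose_mul_mul_same _))
  exact ⟨hX.1, hpsd.posDef_iff_isUnit.2 ((Matrix.isUnit_iff_isUnit_det _).2 (Ne.isUnit hX.1.2))⟩

end CDARE

/-! ### Composition of the maps attached to triples -/

namespace AGH

variable {n : ℕ}

/-- The fractional linear map `X ↦ Aᴴ X (I + G X)⁻¹ A + H` attached to the triple `L` is defined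
at `X` and takes the value `Y` there. -/
def Maps (L : AGH n) (X Y : Matrix (Fin n) (Fin n) ℂ) : Prop :=
  (1 + L.G * X).det ≠ 0 ∧ L.Aᴴ * X * (1 + L.G * X)⁻¹ * L.A + L.H = Y

/-- Both `G` and `H` are Hermitian. -/
def Herm (L : AGH n) : Prop := L.G.IsHermitian ∧ L.H.IsHermitian

theorem conjTranspose_inv_one_add_mul {G H : Matrix (Fin n) (Fin n) ℂ} (hG : G.IsHermitian)
    (hH : H.IsHermitian) : ((1 + G * H)⁻¹)ᴴ = (1 + H * G)⁻¹ := by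
  rw [conjTranspose_nonsing_inv, conjTranspose_add, conjTranspose_one, conjTranspose_mul, hG.eq,
    hH.eq]

theorem isUnit_det_one_add_mul_comm {G H : Matrix (Fin n) (Fin n) ℂ}
    (h : (1 + G * H).det ≠ 0) : IsUnit (1 + H * G).det :=
  Ne.isUnit (by rwa [← det_one_add_mul_comm])

theorem mul_inv_one_add_mul_comm {G H : Matrix (Fin n) (Fin n) ℂ} (h : (1 + G * H).det ≠ 0) :
    H * (1 + G * H)⁻¹ = (1 + H * G)⁻¹ * H := by
  have h1 : (1 + H * G) * H = H * (1 + G * H) := by noncomm_ring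
  have h2 := isUnit_det_one_add_mul_comm h
  calc H * (1 + G * H)⁻¹ = (1 + H * G)⁻¹ * ((1 + H * G) * H) * (1 + G * H)⁻¹ := by
        rw [← Matrix.mul_assoc, nonsing_inv_mul _ h2, Matrix.one_mul]
    _ = _ := by
        rw [h1, Matrix.mul_assoc, Matrix.mul_assoc, mul_nonsing_inv _ (Ne.isUnit h),
          Matrix.mul_one]

theorem isHermitian_mul_inv_one_add {G H : Matrix (Fin n) (Fin n) ℂ} (hG : G.IsHermitian)
    (hH : H.IsHermitian) (h : (1 + G * H).det ≠ 0) : (H * (1 + G * H)⁻¹).IsHermitian := by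
  rw [Matrix.IsHermitian, conjTranspose_mul, conjTranspose_inv_one_add_mul hG hH, hH.eq,
    mul_inv_one_add_mul_comm h]

theorem Herm.step {S L : AGH n} (hS : S.Herm) (hL : L.Herm)
    (h : (1 + S.G * L.H).det ≠ 0) : (step S L).Herm := by
  constructor
  · have h1 := isHermitian_mul_inv_one_add hL.2 hS.1 (isUnit_det_one_add_mul_comm h).ne_zero
    rw [mul_inv_one_add_mul_comm (isUnit_det_one_add_mul_comm h).ne_zero] at h1
    have := hL.1.add (isHermitian_mul_mul_conjTranspose L.A h1)
    simpa only [AGH.step, Matrix.mul_assoc] using this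
  · have := hS.2.add (isHermitian_conjTranspose_mul_mul S.A (isHermitian_mul_inv_one_add hS.1 hL.2 h))
    simpa only [AGH.step, Matrix.mul_assoc] using this

/-- The map attached to `step S L` is the composition of those attached to `L` and `S`. -/
theorem Maps.step {S L : AGH n} {X Y Z : Matrix (Fin n) (Fin n) ℂ} (hS : S.Herm) (hL : L.Herm)
    (h : (1 + S.G * L.H).det ≠ 0) (h1 : L.Maps X Y) (h2 : S.Maps Y Z) :
    (AGH.step S L).Maps X Z := by
  obtain ⟨d1, e1⟩ := h1
  obtain ⟨d2, e2⟩ := h2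
  set W := (1 + L.G * X)⁻¹ with hW
  set D := (1 + S.G * L.H)⁻¹ with hD
  have hWr : (1 + L.G * X) * W = 1 := mul_nonsing_inv _ (Ne.isUnit d1)
  have hWl : W * (1 + L.G * X) = 1 := nonsing_inv_mul _ (Ne.isUnit d1)
  have hDr : (1 + S.G * L.H) * D = 1 := mul_nonsing_inv _ (Ne.isUnit h)
  have hDl : D * (1 + S.G * L.H) = 1 := nonsing_inv_mul _ (Ne.isUnit h)
  have hG : (AGH.step S L).G = L.G + L.A * D * S.G * L.Aᴴ := rfl
  have hA : (AGH.step S L).A = L.A * D * S.A := rfl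
  have hH : (AGH.step S L).H = S.H + S.Aᴴ * L.H * D * S.A := rfl
  -- Up to the swap det(1 + PQ) = det(1 + QP), the composed denominator factors into `D` and the
  -- denominators of the two maps.
  have hdet : (1 + (AGH.step S L).G * X).det ≠ 0 := by
    have f1 : 1 + (AGH.step S L).G * X
        = (1 + L.A * (D * S.G * L.Aᴴ * X * W)) * (1 + L.G * X) := by
      calc _ = (1 + L.G * X) + L.A * D * S.G * L.Aᴴ * X * 1 := by rw [hG]; noncomm_ring
        _ = (1 + L.G * X) + L.A * D * S.G * L.Aᴴ * X * (W * (1 + L.G * X)) := by rw [hWl]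
        _ = _ := by noncomm_ring
    have f2 : 1 + (D * S.G * L.Aᴴ * X * W) * L.A = D * (1 + S.G * Y) := by
      calc _ = D * (1 + S.G * L.H) + D * S.G * L.Aᴴ * X * W * L.A := by rw [hDl]
        _ = _ := by rw [← e1]; noncomm_ring
    rw [f1, det_mul, det_one_add_mul_comm, f2, det_mul]
    refine mul_ne_zero (mul_ne_zero ?_ d2) d1
    exact (isUnit_nonsing_inv_det _ (Ne.isUnit h)).ne_zero
  refine ⟨hdet, ?_⟩
  set V := (1 + S.G * Y)⁻¹ * S.A with hV
  have hVeq : V + S.G * L.H * V + S.G * L.Aᴴ * X * (W * L.A * V) = S.A := by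
    calc _ = (1 + S.G * Y) * V := by rw [← e1]; noncomm_ring
      _ = S.A := mul_nonsing_inv_cancel_left _ _ (Ne.isUnit d2)
  have hV' : V = D * S.A - D * S.G * L.Aᴴ * X * (W * L.A * V) := by
    calc V = D * (1 + S.G * L.H) * V := by rw [hDl, Matrix.one_mul]
      _ = D * (V + S.G * L.H * V + S.G * L.Aᴴ * X * (W * L.A * V))
          - D * S.G * L.Aᴴ * X * (W * L.A * V) := by noncomm_ring
      _ = _ := by rw [hVeq]
  -- `W * L.A * V` chains the inverse factors of the two maps; `hV'` expresses `V` without `Y`.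
  have hQ : (1 + (AGH.step S L).G * X)⁻¹ * (AGH.step S L).A = W * L.A * V := by
    have : (1 + (AGH.step S L).G * X) * (W * L.A * V) = (AGH.step S L).A := by
      calc _ = ((1 + L.G * X) * W) * L.A * V
            + L.A * D * S.G * L.Aᴴ * X * (W * L.A * V) := by rw [hG]; noncomm_ring
        _ = L.A * (D * S.A - D * S.G * L.Aᴴ * X * (W * L.A * V))
            + L.A * D * S.G * L.Aᴴ * X * (W * L.A * V) := by rw [hWr, Matrix.one_mul, ← hV']
        _ = _ := by rw [hA]; noncomm_ring
    rw [← this, nonsing_inv_mul_cancel_left _ _ (Ne.isUnit hdet)]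
  have hDH : Dᴴ = 1 - L.H * D * S.G := by
    rw [hD, conjTranspose_inv_one_add_mul hS.1 hL.2]
    refine Matrix.inv_eq_right_inv ?_
    rw [← hD]
    calc (1 + L.H * S.G) * (1 - L.H * D * S.G)
        = 1 + L.H * S.G - L.H * ((1 + S.G * L.H) * D) * S.G := by noncomm_ring
      _ = 1 := by rw [hDr]; noncomm_ring
  calc (AGH.step S L).Aᴴ * X * (1 + (AGH.step S L).G * X)⁻¹ * (AGH.step S L).A + (AGH.step S L).H
      = S.Aᴴ * (1 - L.H * D * S.G) * L.Aᴴ * X * (W * L.A * V)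
        + (S.H + S.Aᴴ * L.H * D * S.A) := by
        rw [Matrix.mul_assoc _ _ (AGH.step S L).A, hQ, hA, hH, conjTranspose_mul,
          conjTranspose_mul, hDH]
        noncomm_ring
    _ = S.Aᴴ * L.H * (D * S.A - D * S.G * L.Aᴴ * X * (W * L.A * V))
        + S.Aᴴ * L.Aᴴ * X * W * L.A * V + S.H := by noncomm_ring
    _ = S.Aᴴ * Y * V + S.H := by rw [← hV', ← e1]; noncomm_ring
    _ = Z := by rw [← e2, hV]; noncomm_ring

theorem Herm.inner {S : AGH n} (hS : S.Herm) :
    ∀ l : ℕ, (∀ i < l, (1 + S.G * (inner S i).H).det ≠ 0) → (inner S l).Herm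
  | 0, _ => hS
  | l + 1, h => Herm.step hS (Herm.inner hS l fun i hi => h i (by omega)) (h l (by omega))

/-- If `S` maps `X j` to `X (j + s)` for all `j`, then its inner iterate maps `X j` to
`X (j + (l + 1) * s)`. -/
theorem Maps.inner {S : AGH n} (hS : S.Herm) {X : ℕ → Matrix (Fin n) (Fin n) ℂ} {s : ℕ}
    (hX : ∀ j, S.Maps (X j) (X (j + s))) :
    ∀ l : ℕ, (∀ i < l, (1 + S.G * (AGH.inner S i).H).det ≠ 0) →
      ∀ j, (AGH.inner S l).Maps (X j) (X (j + (l + 1) * s))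
  | 0, _, j => by simpa [AGH.inner] using hX j
  | l + 1, h, j => by
    have h1 := Maps.inner hS hX l (fun i hi => h i (by omega)) j
    have h2 := Maps.step hS (Herm.inner hS l fun i hi => h i (by omega)) (h l (by omega)) h1 (hX _)
    rwa [show j + (l + 1) * s + s = j + (l + 1 + 1) * s by ring] at h2

/-- Each outer step composes r copies of the current map, multiplying the stride by r. Following a
single orbit suffices: the maps need not be defined elsewhere. -/
theorem Maps.outer {S : AGH n} (hS : S.Herm) {r : ℕ} (hr : 1 < r) (hwd : NoBreakdown S r)
    {X : ℕ → Matrix (Fin n) (Fin n) ℂ} {s : ℕ} (hX : ∀ j, S.Maps (X j) (X (j + s))) (k : ℕ) :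
    (outer S r k).Herm ∧ ∀ j, (AGH.outer S r k).Maps (X j) (X (j + r ^ k * s)) := by
  induction k with
  | zero => exact ⟨hS, by simpa [AGH.outer] using hX⟩
  | succ k ih =>
    have hnb : ∀ i < r - 1,
        (1 + (AGH.outer S r k).G * (AGH.inner (AGH.outer S r k) i).H).det ≠ 0 :=
      fun i hi => hwd k i (by omega)
    refine ⟨Herm.inner ih.1 _ hnb, fun j => ?_⟩
    have := Maps.inner ih.1 ih.2 _ hnb j
    rwa [show (r - 1 + 1) * (r ^ k * s) = r ^ (k + 1) * s by
      rw [Nat.sub_add_cancel hr.le]; ring] at this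

end AGH

/-! ### The transformed DARE as the twofold conjugate Riccati map. -/

namespace CDARE

variable {n m : ℕ} (E : CDARE n m)

theorem det_RX (hRdet : E.R.det ≠ 0) (X : Matrix (Fin n) (Fin n) ℂ) :
    (E.RX X).det = E.R.det * (1 + E.G * cconj X).det := by
  have h : E.RX X = E.R * (1 + (E.R⁻¹ * E.Bᴴ * cconj X) * E.B) := by
    simp only [RX, Matrix.mul_add, Matrix.mul_one, Matrix.mul_assoc,
      mul_nonsing_inv_cancel_left _ _ (Ne.isUnit hRdet)]
  rw [h, det_mul, det_one_add_mul_comm]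
  simp only [G, Matrix.mul_assoc]

theorem inv_one_add_G_mul (hRdet : E.R.det ≠ 0) {X : Matrix (Fin n) (Fin n) ℂ}
    (hX : (E.RX X).det ≠ 0) :
    (1 + E.G * cconj X)⁻¹ = 1 - E.B * (E.RX X)⁻¹ * E.Bᴴ * cconj X := by
  refine Matrix.inv_eq_right_inv ?_
  have h1 : E.R⁻¹ * (E.RX X * (E.RX X)⁻¹)
      = (E.RX X)⁻¹ + E.R⁻¹ * E.Bᴴ * cconj X * E.B * (E.RX X)⁻¹ := by
    nth_rw 1 [RX]
    simp only [Matrix.add_mul, Matrix.mul_add, Matrix.mul_assoc,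
      nonsing_inv_mul_cancel_left _ _ (Ne.isUnit hRdet)]
  rw [mul_nonsing_inv _ (Ne.isUnit hX), Matrix.mul_one] at h1
  have h2 := congrArg (fun K => E.B * K * (E.Bᴴ * cconj X)) h1
  simp only [Matrix.add_mul, Matrix.mul_add, Matrix.mul_sub, Matrix.one_mul, Matrix.mul_one,
    Matrix.mul_assoc, G] at h2 ⊢
  rw [h2]
  abel

theorem inv_one_add_G_mul_G (hRdet : E.R.det ≠ 0) {X : Matrix (Fin n) (Fin n) ℂ}
    (hX : (E.RX X).det ≠ 0) :
    (1 + E.G * cconj X)⁻¹ * E.G = E.B * (E.RX X)⁻¹ * E.Bᴴ := by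
  have h1 : (E.RX X)⁻¹ * E.RX X * E.R⁻¹
      = (E.RX X)⁻¹ + (E.RX X)⁻¹ * E.Bᴴ * cconj X * E.B * E.R⁻¹ := by
    nth_rw 2 [RX]
    simp only [Matrix.add_mul, Matrix.mul_add, Matrix.mul_assoc,
      mul_nonsing_inv _ (Ne.isUnit hRdet), Matrix.mul_one]
  rw [nonsing_inv_mul _ (Ne.isUnit hX), Matrix.one_mul] at h1
  rw [E.inv_one_add_G_mul hRdet hX]
  have h2 := congrArg (fun K => E.B * K * E.Bᴴ) h1
  simp only [Matrix.add_mul, Matrix.mul_add, Matrix.sub_mul, Matrix.one_mul, Matrix.mul_assoc,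
    G] at h2 ⊢
  rw [sub_eq_iff_eq_add]
  exact h2

/-- The triple `(A, G, H)` of the CDARE. -/
noncomputable def baseAGH : AGH n := ⟨E.A, E.G, E.H⟩

/-- The entrywise conjugate of the triple `(A, G, H)`. -/
noncomputable def conjAGH : AGH n := ⟨cconj E.A, cconj E.G, cconj E.H⟩

theorem herm_baseAGH (hR : E.R.IsHermitian) (hH : E.H.IsHermitian) : E.baseAGH.Herm :=
  ⟨isHermitian_mul_mul_conjTranspose _ hR.inv, hH⟩

theorem herm_conjAGH (hR : E.R.IsHermitian) (hH : E.H.IsHermitian) : E.conjAGH.Herm :=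
  ⟨IsHermitian.cconj (E.herm_baseAGH hR hH).1, IsHermitian.cconj hH⟩

theorem det_one_add_G_mul_ne_zero (hRdet : E.R.det ≠ 0) {X : Matrix (Fin n) (Fin n) ℂ}
    (hX : (E.RX X).det ≠ 0) : (1 + E.G * cconj X).det ≠ 0 := by
  rw [E.det_RX hRdet] at hX
  exact right_ne_zero_of_mul hX

theorem baseAGH_maps (hRdet : E.R.det ≠ 0) {X : Matrix (Fin n) (Fin n) ℂ}
    (hX : (E.RX X).det ≠ 0) : E.baseAGH.Maps (cconj X) (E.ric X) := by
  refine ⟨E.det_one_add_G_mul_ne_zero hRdet hX, ?_⟩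
  simp only [baseAGH, E.inv_one_add_G_mul hRdet hX, ric, Matrix.mul_sub, Matrix.sub_mul,
    Matrix.mul_one, Matrix.mul_assoc]

theorem conjAGH_maps (hRdet : E.R.det ≠ 0) {X : Matrix (Fin n) (Fin n) ℂ}
    (hX : (E.RX X).det ≠ 0) : E.conjAGH.Maps X (cconj (E.ric X)) := by
  obtain ⟨h1, h2⟩ := E.baseAGH_maps hRdet hX
  have h3 : 1 + E.conjAGH.G * X = cconj (1 + E.G * cconj X) := by
    rw [cconj_add, cconj_one, cconj_mul, cconj_cconj]; rfl
  refine ⟨?_, ?_⟩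
  · rw [h3, det_cconj]
    exact star_ne_zero.2 h1
  · rw [h3, ← h2]
    simp only [conjAGH, baseAGH, cconj_add, cconj_mul, cconj_cconj, cconj_conjTranspose,
      cconj_inv]

/-- Since `ric X` depends on conj X, applying `ric` twice is the conjugated triple followed by the
original one. Nonsingularity of R_H is what makes this composition defined. -/
theorem hatAGH_eq_step (hRdet : E.R.det ≠ 0) (hRH : (E.RX E.H).det ≠ 0) :
    E.hatAGH = AGH.step E.baseAGH E.conjAGH := by
  have hA : E.hatA = cconj E.A * (1 + E.G * cconj E.H)⁻¹ * E.A := by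
    rw [E.inv_one_add_G_mul hRdet hRH, hatA]
    simp only [Matrix.mul_sub, Matrix.sub_mul, Matrix.mul_one, Matrix.mul_assoc]
  have hinv : E.hatR⁻¹ = fromBlocks (cconj E.R)⁻¹ 0 0 (E.RX E.H)⁻¹ := by
    refine Matrix.inv_eq_right_inv ?_
    have hc : IsUnit (cconj E.R).det := by
      rw [det_cconj]; exact Ne.isUnit (star_ne_zero.2 hRdet)
    simp [hatR, fromBlocks_multiply, mul_nonsing_inv _ hc, mul_nonsing_inv _ (Ne.isUnit hRH)]
  have hG : E.hatG = cconj E.G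
      + cconj E.A * (1 + E.G * cconj E.H)⁻¹ * E.G * (cconj E.A)ᴴ := by
    rw [Matrix.mul_assoc (cconj E.A), E.inv_one_add_G_mul_G hRdet hRH, hatG, hinv, hatB,
      conjTranspose_fromCols_eq_fromRows_conjTranspose, fromCols_mul_fromBlocks,
      fromCols_mul_fromRows]
    simp [G, cconj_mul, cconj_inv, cconj_conjTranspose, Matrix.mul_assoc]
  rw [hatAGH, hA, hG]
  rfl

theorem herm_hatAGH (hR : E.R.IsHermitian) (hRdet : E.R.det ≠ 0) (hH : E.H.IsHermitian)
    (hRH : (E.RX E.H).det ≠ 0) : E.hatAGH.Herm := by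
  rw [E.hatAGH_eq_step hRdet hRH]
  exact (E.herm_baseAGH hR hH).step (E.herm_conjAGH hR hH) (E.det_one_add_G_mul_ne_zero hRdet hRH)

/-- The transformed Riccati operator is the square of the conjugate Riccati operator. -/
theorem hatAGH_maps (hR : E.R.IsHermitian) (hRdet : E.R.det ≠ 0) (hH : E.H.IsHermitian)
    (hRH : (E.RX E.H).det ≠ 0) {X : Matrix (Fin n) (Fin n) ℂ} (hX : (E.RX X).det ≠ 0)
    (hX' : (E.RX (E.ric X)).det ≠ 0) : E.hatAGH.Maps X (E.ric (E.ric X)) := by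
  rw [E.hatAGH_eq_step hRdet hRH]
  exact AGH.Maps.step (E.herm_baseAGH hR hH) (E.herm_conjAGH hR hH)
    (E.det_one_add_G_mul_ne_zero hRdet hRH) (E.conjAGH_maps hRdet hX) (E.baseAGH_maps hRdet hX')

end CDARE

/-! ### Powers and the spectral radius -/

section SpectralRadius

variable {A : Type*} [NormedRing A] [NormedAlgebra ℂ A] [CompleteSpace A]

theorem tendsto_enorm_pow_rpow_inv (a : A) :
    Tendsto (fun k : ℕ => ‖a ^ k‖ₑ ^ ((k : ℝ)⁻¹)) atTop (𝓝 (spectralRadius ℂ a)) := by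
  simpa [enorm_eq_nnnorm] using spectrum.pow_nnnorm_pow_one_div_tendsto_nhds_spectralRadius a

theorem tendsto_pow_zero_of_spectralRadius_lt_one {a : A} (ha : spectralRadius ℂ a < 1) :
    Tendsto (fun k : ℕ => a ^ k) atTop (𝓝 0) := by
  obtain ⟨s, hs, hs1⟩ := exists_between ha
  rw [tendsto_iff_enorm_sub_tendsto_zero]
  refine tendsto_of_tendsto_of_tendsto_of_le_of_le' tendsto_const_nhds
    (ENNReal.tendsto_pow_atTop_nhds_zero_of_lt_one hs1) (Eventually.of_forall fun _ => zero_le) ?_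
  filter_upwards [(tendsto_enorm_pow_rpow_inv a).eventually_lt_const hs, eventually_gt_atTop 0]
    with k hk hk0
  rw [sub_zero, ← ENNReal.rpow_natCast]
  exact (ENNReal.rpow_inv_le_iff (by exact_mod_cast hk0)).1 hk.le

end SpectralRadius

/-! ### Stein inequalities and monotone convergence -/

section Order

variable {n : ℕ}

theorem star_pow_mul_mul_pow_le {D T : Matrix (Fin n) (Fin n) ℂ} (h : star T * D * T ≤ D) :
    ∀ k : ℕ, star (T ^ k) * D * T ^ k ≤ D
  | 0 => by simp
  | k + 1 => by
    have h1 := star_left_conjugate_le_conjugate (star_pow_mul_mul_pow_le h k) T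
    refine le_trans (le_of_eq ?_) (h1.trans h)
    simp only [pow_succ, star_mul, mul_assoc]

/-- Iterating the inequality bounds `D` below by congruences with `T ^ k`, which tend to 0. -/
theorem nonneg_of_star_mul_mul_le {D T : Matrix (Fin n) (Fin n) ℂ}
    (hT : spectralRadius ℂ T < 1) (h : star T * D * T ≤ D) : 0 ≤ D := by
  have h1 := tendsto_pow_zero_of_spectralRadius_lt_one hT
  have h2 : Tendsto (fun k : ℕ => star (T ^ k) * D * T ^ k) atTop (𝓝 0) := by
    simpa using (h1.star.mul_const D).mul h1
  exact le_of_tendsto' h2 (star_pow_mul_mul_pow_le h)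

/-- The spectral norm is monotone on positive semidefinite matrices, so order intervals are bounded.
-/
theorem isCompact_Icc_matrix (a b : Matrix (Fin n) (Fin n) ℂ) : IsCompact (Set.Icc a b) := by
  refine Metric.isCompact_of_isClosed_isBounded isClosed_Icc ?_
  refine (Metric.isBounded_closedBall (x := a) (r := ‖b - a‖)).subset fun x hx => ?_
  rw [mem_closedBall_iff_norm]
  exact CStarAlgebra.norm_le_norm_of_nonneg_of_le (sub_nonneg.2 hx.1) (sub_le_sub_right hx.2 a)

/-- An antitone sequence of matrices that is bounded below in the Loewner order converges. -/
theorem exists_tendsto_of_antitone {X : ℕ → Matrix (Fin n) (Fin n) ℂ} (hX : Antitone X)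
    {a : Matrix (Fin n) (Fin n) ℂ} (ha : ∀ j, a ≤ X j) : ∃ L, Tendsto X atTop (𝓝 L) := by
  have hK := isCompact_Icc_matrix a (X 0)
  have hmem : ∀ j, X j ∈ Set.Icc a (X 0) := fun j => ⟨ha j, hX (Nat.zero_le j)⟩
  obtain ⟨L, -, φ, hφ, hL⟩ := hK.tendsto_subseq hmem
  have hlb : ∀ j, L ≤ X j := fun j =>
    le_of_tendsto hL ((eventually_ge_atTop j).mono fun i hi => hX (hi.trans (hφ.id_le i)))
  -- By monotonicity any two cluster points bound each other, so the cluster point is unique.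
  refine ⟨L, hK.tendsto_nhds_of_unique_mapClusterPt (Eventually.of_forall hmem) fun y _ hy => ?_⟩
  obtain ⟨ψ, hψ, hy⟩ := hy.tendsto_subseq
  refine le_antisymm (ge_of_tendsto' hL fun i => ?_) (ge_of_tendsto' hy fun i => hlb _)
  exact le_of_tendsto hy ((eventually_ge_atTop (φ i)).mono fun j hj => hX (hj.trans (hψ.id_le j)))

end Order

/-! ### The plain fixed-point iteration: monotonicity, limit and error bound. -/

namespace CDARE

variable {n m : ℕ} (E : CDARE n m)

/-- Substituting the conjugated inequality into itself gives a Stein inequality for T̂_W without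
conjugation. -/
theorem nonneg_of_closedLoop_le {W D : Matrix (Fin n) (Fin n) ℂ} (hW : W ∈ E.stabSet)
    (h : (E.closedLoop W)ᴴ * cconj D * E.closedLoop W ≤ D) : 0 ≤ D := by
  refine nonneg_of_star_mul_mul_le hW.2 (le_trans ?_ h)
  have h1 := conjTranspose_mul_mul_mono (cconj_mono h) (E.closedLoop W)
  refine le_trans (le_of_eq ?_) h1
  simp only [closedLoopHat, star_eq_conjTranspose, conjTranspose_mul, cconj_mul, cconj_cconj,
    cconj_conjTranspose, Matrix.mul_assoc]

/-- Admissible initial matrices dominate every `Z` with `Z ≤ ric Z` and `R_Z > 0`. -/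
theorem le_of_mem_startSet (hR : E.R.IsHermitian) {X Z : Matrix (Fin n) (Fin n) ℂ}
    (hX : X ∈ E.startSet) (hZ : Z ∈ E.ricLE) (hZp : Z ∈ E.posSet) : Z ≤ X := by
  obtain ⟨-, W, hW, h⟩ := hX
  rw [← sub_nonneg]
  refine E.nonneg_of_closedLoop_le hW ?_
  have h1 : Z ≤ (E.closedLoop W)ᴴ * cconj Z * E.closedLoop W
      + (E.feedback W)ᴴ * E.R * E.feedback W + E.H :=
    hZ.2.trans (E.ric_le hR hZp (E.feedback W))
  have h2 := add_le_add h h1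
  rw [← sub_nonneg] at h2 ⊢
  refine le_of_le_of_eq h2 ?_
  rw [cconj_sub, Matrix.mul_sub, Matrix.sub_mul]
  abel

theorem ric_le_of_mem_startSet (hR : E.R.IsHermitian) {X : Matrix (Fin n) (Fin n) ℂ}
    (hX : X ∈ E.startSet) (hXp : X ∈ E.posSet) : E.ric X ≤ X := by
  obtain ⟨-, W, hW, h⟩ := hX
  refine (E.ric_le hR hXp (E.feedback W)).trans ?_
  rw [← sub_nonneg] at h ⊢
  refine le_of_le_of_eq h ?_
  simp only [closedLoop]
  abel

theorem iterate_ric_ge (hR : E.R.IsHermitian) {X Z : Matrix (Fin n) (Fin n) ℂ}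
    (hZ : Z ∈ E.ricLE) (hZp : Z ∈ E.posSet) (h : Z ≤ X) (j : ℕ) : Z ≤ E.ric^[j] X := by
  induction j with
  | zero => exact h
  | succ j ih =>
    rw [Function.iterate_succ_apply']
    exact hZ.2.trans (E.ric_mono hR hZp ih)

theorem antitone_iterate_ric (hR : E.R.IsHermitian) {X Z : Matrix (Fin n) (Fin n) ℂ}
    (hZ : Z ∈ E.ricLE) (hZp : Z ∈ E.posSet) (h : Z ≤ X) (hX : E.ric X ≤ X) :
    Antitone fun j => E.ric^[j] X := by
  refine antitone_nat_of_succ_le fun j => ?_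
  induction j with
  | zero => exact hX
  | succ j ih =>
    rw [Function.iterate_succ_apply' E.ric (j + 1), Function.iterate_succ_apply' E.ric j]
    rw [Function.iterate_succ_apply'] at ih
    refine E.ric_mono hR (E.mem_posSet_of_le hZp ?_) ih
    rw [← Function.iterate_succ_apply' E.ric]
    exact E.iterate_ric_ge hR hZ hZp h (j + 1)

theorem continuous_RX : Continuous E.RX :=
  continuous_const.add ((continuous_const.matrix_mul continuous_cconj).matrix_mul continuous_const)

theorem continuousAt_ric {X : Matrix (Fin n) (Fin n) ℂ} (hX : (E.RX X).det ≠ 0) :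
    ContinuousAt E.ric X := by
  have h1 : ContinuousAt (fun Y => (E.RX Y)⁻¹) X := by
    -- The matrix inverse is `Ring.inverse` of the determinant times the adjugate.
    have h2 : ContinuousAt (fun Y => Ring.inverse (E.RX Y).det) X :=
      ContinuousAt.comp (f := fun Y => (E.RX Y).det)
        (NormedRing.inverse_continuousAt (Units.mk0 _ hX)) E.continuous_RX.matrix_det.continuousAt
    exact h2.smul E.continuous_RX.matrix_adjugate.continuousAt
  have hc := continuous_cconj (p := Fin n) (q := Fin n)
  have h3 : ContinuousAt (fun Y => E.Aᴴ * cconj Y * E.B * (E.RX Y)⁻¹) X :=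
    ContinuousAt.comp (g := fun P : Matrix (Fin n) (Fin m) ℂ × Matrix (Fin m) (Fin m) ℂ => P.1 * P.2)
      (f := fun Y => (E.Aᴴ * cconj Y * E.B, (E.RX Y)⁻¹))
      (continuous_fst.matrix_mul continuous_snd).continuousAt
      (((continuous_const.matrix_mul hc).matrix_mul continuous_const).continuousAt.prodMk h1)
  have h4 : ContinuousAt (fun Y => E.Aᴴ * cconj Y * E.B * (E.RX Y)⁻¹ * (E.Bᴴ * cconj Y * E.A)) X :=
    ContinuousAt.comp (g := fun P : Matrix (Fin n) (Fin m) ℂ × Matrix (Fin m) (Fin n) ℂ => P.1 * P.2)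
      (f := fun Y => (E.Aᴴ * cconj Y * E.B * (E.RX Y)⁻¹, E.Bᴴ * cconj Y * E.A))
      (continuous_fst.matrix_mul continuous_snd).continuousAt
      (h3.prodMk ((continuous_const.matrix_mul hc).matrix_mul continuous_const).continuousAt)
  have h5 : E.ric = fun Y => E.Aᴴ * cconj Y * E.A
      - E.Aᴴ * cconj Y * E.B * (E.RX Y)⁻¹ * (E.Bᴴ * cconj Y * E.A) + E.H := by
    funext Y; simp only [ric, Matrix.mul_assoc]
  rw [h5]
  exact (((continuous_const.matrix_mul hc).matrix_mul continuous_const).continuousAt.sub h4).add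
    continuousAt_const

/-- The fixed-point iteration `X ↦ ric X` started in an admissible matrix decreases to the maximal
solution. -/
theorem exists_maximal_solution (hR : E.R.IsHermitian) {X Z : Matrix (Fin n) (Fin n) ℂ}
    (hZ : Z ∈ E.ricLE) (hZp : Z ∈ E.posSet) (hX : X ∈ E.startSet) :
    ∃ XM, IsGreatest E.solutions XM ∧ XM ∈ E.posSet ∧
      Tendsto (fun j => E.ric^[j] X) atTop (𝓝 XM) := by
  have hle := E.le_of_mem_startSet hR hX hZ hZp
  have hanti := E.antitone_iterate_ric hR hZ hZp hle
    (E.ric_le_of_mem_startSet hR hX (E.mem_posSet_of_le hZp hle))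
  obtain ⟨XM, hlim⟩ := exists_tendsto_of_antitone hanti (E.iterate_ric_ge hR hZ hZp hle)
  have hpos := E.mem_posSet_of_le hZp (ge_of_tendsto' hlim (E.iterate_ric_ge hR hZ hZp hle))
  refine ⟨XM, ⟨⟨hpos.1, ?_⟩, fun Y hY => ?_⟩, hpos, hlim⟩
  · refine tendsto_nhds_unique ((tendsto_add_atTop_iff_nat 1).2 hlim) ?_
    simp only [Function.iterate_succ_apply']
    exact (E.continuousAt_ric hpos.1.2).tendsto.comp hlim
  · have hYp := E.mem_posSet_of_mem_solutions hR hZ hZp hY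
    have hYle : Y ∈ E.ricLE := ⟨hY.1, hY.2.le⟩
    exact ge_of_tendsto' hlim
      (E.iterate_ric_ge hR hYle hYp (E.le_of_mem_startSet hR hX hYle hYp))

/-- Error bound for two steps of the fixed-point iteration. -/
theorem iterate_ric_sub_le (hR : E.R.IsHermitian) {X Y : Matrix (Fin n) (Fin n) ℂ}
    (hY : Y ∈ E.solutions) (hYp : Y ∈ E.posSet) (h : Y ≤ X) (j : ℕ) :
    E.ric^[2 * j] X - Y
      ≤ star (E.closedLoopHat Y ^ j) * (X - Y) * E.closedLoopHat Y ^ j := by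
  have hYle : Y ∈ E.ricLE := ⟨hY.1, hY.2.le⟩
  have hmem : ∀ i, E.ric^[i] X ∈ E.posSet := fun i =>
    E.mem_posSet_of_le hYp (E.iterate_ric_ge hR hYle hYp h i)
  induction j with
  | zero => simp
  | succ j ih =>
    have h1 := E.ric_sub_le hR (hmem (2 * j)) hY
    have h2 := E.ric_sub_le hR (hmem (2 * j + 1)) hY
    have h3 := conjTranspose_mul_mul_mono (cconj_mono (h1.trans
      (conjTranspose_mul_mul_mono (cconj_mono ih) (E.closedLoop Y)))) (E.closedLoop Y)
    rw [← Function.iterate_succ_apply' E.ric] at h1 h2 h3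
    refine (h2.trans h3).trans (le_of_eq ?_)
    rw [pow_succ]
    simp only [closedLoopHat, star_eq_conjTranspose, conjTranspose_mul, cconj_mul, cconj_cconj,
      cconj_conjTranspose, Matrix.mul_assoc]

theorem enorm_iterate_ric_sub_le (hR : E.R.IsHermitian) {X Y : Matrix (Fin n) (Fin n) ℂ}
    (hY : Y ∈ E.solutions) (hYp : Y ∈ E.posSet) (h : Y ≤ X) (j : ℕ) :
    ‖E.ric^[2 * j] X - Y‖ₑ ≤ ‖X - Y‖ₑ * ‖E.closedLoopHat Y ^ j‖ₑ ^ 2 := by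
  have hYle : Y ∈ E.ricLE := ⟨hY.1, hY.2.le⟩
  have h1 := CStarAlgebra.norm_le_norm_of_nonneg_of_le
    (sub_nonneg.2 (E.iterate_ric_ge hR hYle hYp h (2 * j))) (E.iterate_ric_sub_le hR hY hYp h j)
  have h2 : ‖E.ric^[2 * j] X - Y‖ ≤ ‖X - Y‖ * ‖E.closedLoopHat Y ^ j‖ ^ 2 := by
    refine h1.trans ((norm_mul_le _ _).trans ?_)
    refine (mul_le_mul_of_nonneg_right (norm_mul_le _ _) (norm_nonneg _)).trans (le_of_eq ?_)
    rw [norm_star]; ring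
  simp only [enorm_eq_nnnorm]
  exact_mod_cast h2

end CDARE

/-! ### Rates of convergence -/

section Rate

open scoped ENNReal

theorem limsup_rpow_inv_pow_le {A : Type*} [NormedRing A] [NormedAlgebra ℂ A] [CompleteSpace A]
    {T : A} {r : ℕ} (hr : 1 < r) {e : ℕ → ℝ≥0∞} {C : ℝ≥0∞}
    (hC : C ≠ ∞) (he : ∀ᶠ k in atTop, e k ≤ C * ‖T ^ r ^ k‖ₑ ^ 2) :
    limsup (fun k : ℕ => e k ^ (((r : ℝ) ^ k)⁻¹)) atTop ≤ spectralRadius ℂ T ^ 2 := by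
  have hinv : Tendsto (fun k : ℕ => ((r : ℝ) ^ k)⁻¹) atTop (𝓝 0) :=
    (tendsto_pow_atTop_atTop_of_one_lt (by exact_mod_cast hr)).inv_tendsto_atTop
  lift C to NNReal using hC
  -- Replacing `C` by `max C 1` covers `C = 0`, whose positive powers do not tend to 1.
  have h1 : Tendsto (fun k : ℕ => ((max C 1 : NNReal) : ℝ≥0∞) ^ (((r : ℝ) ^ k)⁻¹)) atTop (𝓝 1) := by
    have hne : max C 1 ≠ 0 := (lt_max_of_lt_right one_pos).ne'
    have h := ((NNReal.continuousAt_rpow (x := max C 1) (y := 0) (Or.inl hne)).tendsto).comp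
      ((tendsto_const_nhds (x := max C 1)).prodMk_nhds hinv)
    simp only [Function.comp_def, NNReal.rpow_zero] at h
    have h' := ENNReal.tendsto_coe.2 h
    simpa only [ENNReal.coe_rpow_of_ne_zero hne, ENNReal.coe_one] using h'
  have h2 : Tendsto (fun k : ℕ => ‖T ^ r ^ k‖ₑ ^ (((r : ℝ) ^ k)⁻¹)) atTop
      (𝓝 (spectralRadius ℂ T)) := by
    have := (tendsto_enorm_pow_rpow_inv T).comp (tendsto_pow_atTop_atTop_of_one_lt hr)
    simpa [Function.comp_def] using this
  have h3 := ENNReal.Tendsto.mul h1 (Or.inl one_ne_zero) (ENNReal.Tendsto.pow (n := 2) h2)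
    (Or.inr ENNReal.one_ne_top)
  rw [one_mul] at h3
  rw [← h3.limsup_eq]
  refine limsup_le_limsup ?_
  filter_upwards [he] with k hk
  have hp : 0 ≤ ((r : ℝ) ^ k)⁻¹ := by positivity
  calc e k ^ (((r : ℝ) ^ k)⁻¹)
      ≤ (((max C 1 : NNReal) : ℝ≥0∞) * ‖T ^ r ^ k‖ₑ ^ 2) ^ (((r : ℝ) ^ k)⁻¹) := by
        refine ENNReal.rpow_le_rpow (hk.trans ?_) hp
        gcongr
        exact le_max_left _ _
    _ = _ := by
        rw [ENNReal.mul_rpow_of_nonneg _ _ hp, ← ENNReal.rpow_natCast, ← ENNReal.rpow_natCast,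
          ← ENNReal.rpow_mul, ← ENNReal.rpow_mul, mul_comm ((2 : ℕ) : ℝ)]

/-- Eventually e_k ≤ s^(r^k) with s < 1, and r^k / k → ∞. -/
theorem tendsto_rpow_inv_zero_of_limsup_lt_one {r : ℕ} (hr : 1 < r) {e : ℕ → ℝ≥0∞}
    (h : limsup (fun k : ℕ => e k ^ (((r : ℝ) ^ k)⁻¹)) atTop < 1) :
    Tendsto (fun k : ℕ => e k ^ ((k : ℝ)⁻¹)) atTop (𝓝 0) := by
  obtain ⟨s, hs, hs1⟩ := exists_between h
  have hr' : (1 : ℝ) < r := by exact_mod_cast hr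
  have hexp : Tendsto (fun k : ℕ => (r : ℝ) ^ k * (k : ℝ)⁻¹) atTop atTop := by
    have h0 := tendsto_pow_const_div_const_pow_of_one_lt 1 hr'
    have hpos : ∀ᶠ k : ℕ in atTop, (0 : ℝ) < (k : ℝ) ^ 1 / (r : ℝ) ^ k := by
      filter_upwards [eventually_gt_atTop 0] with k hk
      have : (0 : ℝ) < k := by exact_mod_cast hk
      positivity
    have := (tendsto_nhdsWithin_iff.2 ⟨h0, hpos⟩).inv_tendsto_nhdsGT_zero
    refine this.congr fun k => ?_
    simp [div_eq_mul_inv]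
  have hlim : Tendsto (fun k : ℕ => s ^ ((r : ℝ) ^ k * (k : ℝ)⁻¹)) atTop (𝓝 0) :=
    (ENNReal.tendsto_rpow_atTop_of_base_lt_one hs1).comp hexp
  refine tendsto_of_tendsto_of_tendsto_of_le_of_le' tendsto_const_nhds hlim
    (Eventually.of_forall fun _ => zero_le) ?_
  filter_upwards [eventually_lt_of_limsup_lt hs] with k hk
  rw [ENNReal.rpow_mul]
  exact ENNReal.rpow_le_rpow ((ENNReal.rpow_inv_le_iff (by positivity)).1 hk.le) (by positivity)

end Rate

/-! ### Transfer from the plain iteration to AFPI(r). -/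

theorem mainTheorem3 {n m : ℕ} (E : CDARE n m)
    (hR : E.R.IsHermitian) (hRdet : E.R.det ≠ 0) (hH : E.H.IsHermitian)
    (hRH : (E.RX E.H).det ≠ 0)
    (hT : E.stabSet.Nonempty) (hP : (E.ricLE ∩ E.posSet).Nonempty)
    (r : ℕ) (hr : 1 < r)
    (hwd : AGH.NoBreakdown E.hatAGH r)
    (X₀ : Matrix (Fin n) (Fin n) ℂ) (hX₀ : X₀ ∈ E.startSet) :
    ∃ XM : Matrix (Fin n) (Fin n) ℂ,
      IsGreatest E.solutions XM ∧ XM ∈ E.posSet ∧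
      (∀ k : ℕ, (1 + (AGH.outer E.hatAGH r (k + 1)).G * X₀).det ≠ 0) ∧
      Antitone (AGH.afpi E.hatAGH r X₀) ∧
      Tendsto (AGH.afpi E.hatAGH r X₀) atTop (𝓝 XM) ∧
      (spectralRadius ℂ (E.closedLoopHat XM) < 1 →
        Tendsto (fun k : ℕ => ‖AGH.afpi E.hatAGH r X₀ k - XM‖ₑ ^ ((k : ℝ)⁻¹)) atTop (𝓝 0) ∧
        limsup (fun k : ℕ => ‖AGH.afpi E.hatAGH r X₀ k - XM‖ₑ ^ (((r : ℝ) ^ k)⁻¹)) atTop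
          ≤ spectralRadius ℂ (E.closedLoopHat XM) ^ 2) := by
  obtain ⟨Z, hZ, hZp⟩ := hP
  obtain ⟨XM, hmax, hpos, hlim⟩ := E.exists_maximal_solution hR hZ hZp hX₀
  have hle := E.le_of_mem_startSet hR hX₀ hZ hZp
  have hanti := E.antitone_iterate_ric hR hZ hZp hle
    (E.ric_le_of_mem_startSet hR hX₀ (E.mem_posSet_of_le hZp hle))
  have hdet : ∀ j, (E.RX (E.ric^[j] X₀)).det ≠ 0 := fun j =>
    (E.mem_posSet_of_le hZp (E.iterate_ric_ge hR hZ hZp hle j)).1.2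
  have hmaps : ∀ j, E.hatAGH.Maps (E.ric^[j] X₀) (E.ric^[j + 2] X₀) := fun j => by
    have h := hdet (j + 1)
    rw [Function.iterate_succ_apply'] at h
    rw [Function.iterate_succ_apply', Function.iterate_succ_apply']
    exact E.hatAGH_maps hR hRdet hH hRH (hdet j) h
  have houter := fun k => (AGH.Maps.outer (E.herm_hatAGH hR hRdet hH hRH) hr hwd
    (X := fun j => E.ric^[j] X₀) hmaps k).2 0
  -- The shift is needed: `afpi` at 0 is X₀ itself, not the second iterate of `ric`. This is why k =
  -- 0 is treated apart for monotonicity and discarded for the rate.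
  have hafpi : ∀ k, AGH.afpi E.hatAGH r X₀ (k + 1) = E.ric^[2 * r ^ (k + 1)] X₀ := fun k => by
    have := (houter (k + 1)).2
    rwa [zero_add, mul_comm _ 2] at this
  have hpow : Tendsto (fun k => 2 * r ^ k) atTop atTop :=
    (tendsto_pow_atTop_atTop_of_one_lt hr).const_mul_atTop' two_pos
  have hafpi_lim : Tendsto (AGH.afpi E.hatAGH r X₀) atTop (𝓝 XM) := by
    rw [← tendsto_add_atTop_iff_nat 1]
    simp only [hafpi]
    exact hlim.comp (hpow.comp (tendsto_add_atTop_nat 1))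
  refine ⟨XM, hmax, hpos, fun k => (houter (k + 1)).1, ?_, hafpi_lim, fun hρ => ?_⟩
  · refine antitone_nat_of_succ_le fun k => ?_
    rw [hafpi]
    cases k with
    | zero => exact hanti (Nat.zero_le _)
    | succ k =>
      rw [hafpi]
      exact hanti (Nat.mul_le_mul_left 2 (Nat.pow_le_pow_right hr.le (Nat.le_succ _)))
  · have hXle : XM ≤ X₀ := le_of_tendsto' hlim fun j => hanti (Nat.zero_le j)
    have hrate := limsup_rpow_inv_pow_le (e := fun k => ‖AGH.afpi E.hatAGH r X₀ k - XM‖ₑ)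
      hr (C := ‖X₀ - XM‖ₑ) enorm_ne_top (by
        filter_upwards [eventually_ge_atTop 1] with k hk
        obtain ⟨k, rfl⟩ := Nat.exists_eq_add_of_le' hk
        rw [hafpi]
        exact E.enorm_iterate_ric_sub_le hR hmax.1 hpos hXle _)
    exact ⟨tendsto_rpow_inv_zero_of_limsup_lt_one hr
      (hrate.trans_lt (pow_lt_one₀ zero_le hρ two_ne_zero)), hrate⟩
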